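/- Let $c,\beta:\mathbf R\to\mathbf R$ be (globally) Lipschitz functions such that $$\beta(x)<\min\{0,c(x)\}\qquad\text{for every }x\in\mathbf R ,$$ and let $T>0$ and $x_0\in\mathbf R$. Then the optimal control problem $$\text{minimize in }u:\quad \int_0^T\bigl[c(x(t))\,u(t)^2+u(t)^3\bigr]\,dt$$ subject to $$x'(t)=\bigl[c(x(t))-\beta(x(t))\bigr]u(t)^2+u(t)^3\ \text{ for a.e. }t\in(0,T),\qquad x(0)=x_0,$$ $$u\in L^\infty(0,T),\qquad u(t)\in[1,2]\ \text{ for a.e. }t\in(0,T),$$ where the state $x$ is absolutely continuous on $[0,T]$, admits a solution. That is, there is an admissible control $u$ with a state $x$ such that the cost of $(u,x)$ is less than or equal to the cost of every admissible control-state pair. -/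

import Mathlib

open Set MeasureTheory

namespace ScalarControl

/-- Admissible control-state pairs on `[0, T]` for the scalar control system
`x' = f(x, u)` in `(0, T)`, `x(0) = x₀`, with control constraint `u(t) ∈ K`.
Controls are elements of `L^∞(0, T)` (so the constraint and the state equation
are required for almost every `t`), states are absolutely continuous. -/
structure IsAdmissiblePair (f : ℝ → ℝ → ℝ) (K : Set ℝ) (T x₀ : ℝ) (u x : ℝ → ℝ) : Prop where
  control_memLp : MemLp u ⊤ (volume.restrict (Ioo 0 T))
  control_mem : ∀ᵐ t ∂(volume.restrict (Ioo 0 T)), u t ∈ K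
  state_absolutelyContinuous : AbsolutelyContinuousOnInterval x 0 T
  state_initial : x 0 = x₀
  state_equation : ∀ᵐ t ∂(volume.restrict (Ioo 0 T)), HasDerivAt x (f (x t) (u t)) t

/-- The cost `∫₀ᵀ g(x(t), u(t)) dt`. -/
noncomputable def cost (g : ℝ → ℝ → ℝ) (T : ℝ) (u x : ℝ → ℝ) : ℝ :=
  ∫ t in (0 : ℝ)..T, g (x t) (u t)

/-- `u` is an optimal control: together with some state `x` it is admissible, and no
admissible control-state pair has a smaller cost. -/
def IsOptimalControl (f g : ℝ → ℝ → ℝ) (K : Set ℝ) (T x₀ : ℝ) (u : ℝ → ℝ) : Prop :=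
  ∃ x : ℝ → ℝ, IsAdmissiblePair f K T x₀ u x ∧
    ∀ v y : ℝ → ℝ, IsAdmissiblePair f K T x₀ v y → cost g T u x ≤ cost g T v y

/-- For a continuous running cost the integral defining the cost of an admissible pair
is a genuine one: the integrand is integrable. -/
theorem IsAdmissiblePair.intervalIntegrable_cost {f g : ℝ → ℝ → ℝ} {K : Set ℝ} {T x₀ : ℝ}
    {u x : ℝ → ℝ} (hT : 0 < T) (hg : Continuous fun p : ℝ × ℝ => g p.1 p.2)
    (h : IsAdmissiblePair f K T x₀ u x) :
    IntervalIntegrable (fun t => g (x t) (u t)) volume 0 T := by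
  have hx : ContinuousOn x (Icc 0 T) := by
    have := h.state_absolutelyContinuous.continuousOn
    rwa [uIcc_of_le hT.le] at this
  obtain ⟨R, hR⟩ := isCompact_Icc.exists_bound_of_continuousOn hx
  have hu := h.control_memLp
  have hub : ∀ᵐ t ∂(volume.restrict (Ioo 0 T)),
      ‖u t‖ ≤ (eLpNormEssSup u (volume.restrict (Ioo 0 T))).toReal := by
    have hfin : eLpNormEssSup u (volume.restrict (Ioo 0 T)) ≠ ⊤ := by
      have h2 := hu.2.ne
      rwa [eLpNorm_exponent_top] at h2
    filter_upwards [ae_le_eLpNormEssSup (f := u) (μ := volume.restrict (Ioo 0 T))] with t ht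
    have := ENNReal.toReal_mono hfin ht
    simpa using this
  set M := (eLpNormEssSup u (volume.restrict (Ioo 0 T))).toReal
  obtain ⟨C, hC⟩ := ((isCompact_closedBall (0 : ℝ) R).prod
    (isCompact_closedBall (0 : ℝ) M)).exists_bound_of_continuousOn hg.continuousOn
  rw [intervalIntegrable_iff_integrableOn_Ioo_of_le hT.le]
  have hxm : AEStronglyMeasurable x (volume.restrict (Ioo 0 T)) :=
    (hx.mono Ioo_subset_Icc_self).aestronglyMeasurable measurableSet_Ioo
  refine Integrable.of_bound (C := C)
    (hg.comp_aestronglyMeasurable (hxm.prodMk hu.1)) ?_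
  filter_upwards [hub, ae_restrict_mem measurableSet_Ioo] with t ht1 ht2
  exact hC (x t, u t) ⟨by simpa using hR t (Ioo_subset_Icc_self ht2), by simpa using ht1⟩

end ScalarControl

open Set MeasureTheory

namespace ScalarControl

open Filter Topology NNReal

/-! This is Filippov's method. Write f for the velocity and g for the running cost, so that g = f +
β u². For a fixed state, f is strictly increasing in u on [1, 2] and is a convex increasing function
of u². Hence u² is a concave function of the velocity and, as β < 0, g is a convex one. Take a
minimizing sequence and adjoin the running cost J to the state. Gronwall bounds all trajectories, so
the pairs (x, J) are equi-Lipschitz, and Arzelà–Ascoli gives a uniform limit (x, Z). By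
`le_deriv_of_tendsto_integral`, (x', Z') lies a.e. in every closed half-plane containing the
velocity set {(f, g)(x, v)}. Hence x' = f(x, u) for a control u, measurable by
`exists_measurable_control`, and a supporting line at u gives g(x, u) ≤ Z'. Integrating, the cost of
u is at most Z(T), the infimum. -/

/-- A priori bound: absolutely continuous functions whose derivative grows at most linearly
in the function itself are uniformly bounded on `[0, T]`. -/
theorem exists_bound_of_linear_growth (A x₀ : ℝ) {B T : ℝ} (hT : 0 < T) (hB : 0 ≤ B) :
    ∃ R : ℝ, 0 ≤ R ∧ ∀ x : ℝ → ℝ, AbsolutelyContinuousOnInterval x 0 T → x 0 = x₀ →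
      (∀ᵐ t ∂(volume.restrict (Ioo 0 T)), |deriv x t| ≤ A + B * |x t|) →
      ∀ t ∈ Icc 0 T, |x t| ≤ R := by
  set D : ℝ := |x₀| + |A| * T with hD
  have hD0 : 0 ≤ D := by positivity
  set G : ℝ := gronwallBound 0 B D T
  have hG0 : 0 ≤ G := by
    have := gronwallBound_mono le_rfl hD0 hB hT.le
    rwa [gronwallBound_x0] at this
  refine ⟨D + B * G, by positivity, fun x hac hx0 hder t ht => ?_⟩
  have hcx : ContinuousOn x (Icc 0 T) := by
    have := hac.continuousOn
    rwa [uIcc_of_le hT.le] at this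
  -- The constant extension is continuous on the whole line, so the integral of |X| is
  -- differentiable everywhere.
  set X : ℝ → ℝ := IccExtend hT.le ((Icc 0 T).domRestrict x) with hX
  have hXc : Continuous X := (continuousOn_iff_continuous_domRestrict.1 hcx).Icc_extend'
  have hXx : ∀ t ∈ Icc 0 T, X t = x t := fun t ht => IccExtend_of_mem _ _ ht
  have hXa : Continuous fun t => |X t| := hXc.abs
  -- Gronwall is applied to this integral instead of |x|: it is differentiable at every point and
  -- satisfies y' = |x| ≤ D + B y.
  set y : ℝ → ℝ := fun t => ∫ s in (0 : ℝ)..t, |X s| with hy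
  have hyd : ∀ t, HasDerivAt y |X t| t := fun t =>
    intervalIntegral.integral_hasDerivAt_right (hXa.intervalIntegrable _ _)
      hXa.aestronglyMeasurable.stronglyMeasurableAtFilter hXa.continuousAt
  have key : ∀ t ∈ Icc 0 T, |x t| ≤ D + B * y t := by
    intro t ht
    have hact : AbsolutelyContinuousOnInterval x 0 t := hac.mono (by
      rw [uIcc_of_le ht.1, uIcc_of_le hT.le]; exact Icc_subset_Icc_right ht.2)
    have h1 := hact.integral_deriv_eq_sub
    have hint : IntervalIntegrable (fun s => |A| + B * |X s|) volume 0 t :=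
      (continuous_const.add (continuous_const.mul hXa)).intervalIntegrable _ _
    have h2 : ‖∫ s in (0 : ℝ)..t, deriv x s‖ ≤ ∫ s in (0 : ℝ)..t, (|A| + B * |X s|) := by
      refine intervalIntegral.norm_integral_le_of_norm_le ht.1 ?_ hint
      rw [ae_restrict_iff' measurableSet_Ioo] at hder
      have hne : ∀ᵐ s : ℝ, s ≠ T := by simp [ae_iff]
      filter_upwards [hder, hne] with s hs hsT hst
      have hsI : s ∈ Ioo 0 T := ⟨hst.1, lt_of_le_of_ne (hst.2.trans ht.2) hsT⟩
      rw [hXx s (Ioo_subset_Icc_self hsI), Real.norm_eq_abs]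
      linarith [hs hsI, le_abs_self A]
    have hBX : Continuous fun s => B * |X s| := continuous_const.mul hXa
    rw [h1, hx0, intervalIntegral.integral_add intervalIntegrable_const
      (hBX.intervalIntegrable _ _), intervalIntegral.integral_const_mul,
      intervalIntegral.integral_const, Real.norm_eq_abs] at h2
    have h3 : |x t| ≤ |x₀| + |x t - x₀| := by
      have := abs_add_le x₀ (x t - x₀)
      simpa using this
    have h4 : t * |A| ≤ |A| * T := by nlinarith [abs_nonneg A, ht.2]
    simp only [sub_zero, smul_eq_mul] at h2
    linarith
  have hy0 : ∀ t ∈ Icc 0 T, 0 ≤ y t := fun t ht =>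
    intervalIntegral.integral_nonneg ht.1 fun _ _ => abs_nonneg _
  have hgr : ∀ t ∈ Icc 0 T, ‖y t‖ ≤ gronwallBound 0 B D (t - 0) := by
    refine norm_le_gronwallBound_of_norm_deriv_right_le (f' := fun t => |X t|)
      (fun t _ => (hyd t).continuousAt.continuousWithinAt)
      (fun t _ => (hyd t).hasDerivWithinAt) (by simp [hy]) fun t ht => ?_
    have ht' := Ico_subset_Icc_self ht
    rw [Real.norm_eq_abs, abs_abs, Real.norm_of_nonneg (hy0 t ht'), hXx t ht']
    linarith [key t ht']
  have h5 : y t ≤ G := by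
    have h6 := hgr t ht
    rw [Real.norm_of_nonneg (hy0 t ht), sub_zero] at h6
    exact h6.trans (gronwallBound_mono le_rfl hD0 hB ht.2)
  have := key t ht
  nlinarith

/-! ### Compactness of trajectories -/

/-- The functions on a compact space with a given Lipschitz constant and a given value at
one point form a compact set. -/
theorem isCompact_setOf_lipschitzWith_eq {α E : Type*} [MetricSpace α] [CompactSpace α]
    [NormedAddCommGroup E] [ProperSpace E] {L : ℝ≥0} (o : α) (z₀ : E) {R : ℝ}
    (hR : ∀ t, dist t o ≤ R) :
    IsCompact {h : BoundedContinuousFunction α E | LipschitzWith L h ∧ h o = z₀} := by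
  have heval : ∀ t : α, Continuous fun h : BoundedContinuousFunction α E => h t := fun t =>
    (BoundedContinuousFunction.lipschitz_eval_const t).continuous
  refine BoundedContinuousFunction.arzela_ascoli₂ (Metric.closedBall z₀ (L * R))
    (isCompact_closedBall _ _) _ ?_ (fun h t hh => ?_) ?_
  · simp only [lipschitzWith_iff_dist_le_mul, ofPred_and, ofPred_forall]
    refine (isClosed_iInter fun s => isClosed_iInter fun t => ?_).inter ?_
    · exact isClosed_le ((heval s).dist (heval t)) continuous_const
    · exact isClosed_eq (heval o) continuous_const
  · have h1 := hh.1.dist_le_mul t o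
    rw [hh.2] at h1
    exact h1.trans (mul_le_mul_of_nonneg_left (hR t) L.2)
  · exact (LipschitzWith.uniformEquicontinuous
      (fun h : {h : BoundedContinuousFunction α E | LipschitzWith L h ∧ h o = z₀} => (h.1 : α → E))
      L fun h => h.2.1).equicontinuous

/-- **Arzelà–Ascoli** for sequences of functions on `[0, T]` with a common Lipschitz constant
and a common initial value. -/
theorem exists_subseq_tendstoUniformlyOn_of_lipschitzOnWith {E : Type*} [NormedAddCommGroup E]
    [ProperSpace E] {T : ℝ} (hT : 0 < T) {L : ℝ≥0} {z₀ : E} {z : ℕ → ℝ → E}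
    (hz : ∀ n, LipschitzOnWith L (z n) (Icc 0 T)) (h0 : ∀ n, z n 0 = z₀) :
    ∃ φ : ℕ → ℕ, StrictMono φ ∧ ∃ w : ℝ → E, LipschitzWith L w ∧
      TendstoUniformlyOn (fun n => z (φ n)) w atTop (Icc 0 T) := by
  let o : Icc (0 : ℝ) T := ⟨0, left_mem_Icc.2 hT.le⟩
  have hSK := isCompact_setOf_lipschitzWith_eq (L := L) o z₀ (R := T) fun t => by
    have : dist t o = |(t : ℝ) - 0| := rfl
    rw [this, sub_zero, abs_of_nonneg t.2.1]
    exact t.2.2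
  let Z : ℕ → BoundedContinuousFunction (Icc (0 : ℝ) T) E := fun n =>
    BoundedContinuousFunction.mkOfCompact
      ⟨(Icc 0 T).domRestrict (z n), ((hz n).to_restrict).continuous⟩
  have hZ : ∀ n, Z n ∈
      {h : BoundedContinuousFunction (Icc (0 : ℝ) T) E | LipschitzWith L h ∧ h o = z₀} := fun n =>
    ⟨(hz n).to_restrict, h0 n⟩
  obtain ⟨w, hw, φ, hφ, hlim⟩ := hSK.tendsto_subseq hZ
  refine ⟨φ, hφ, IccExtend hT.le w, ?_, ?_⟩
  · have := hw.1.comp (LipschitzWith.projIcc hT.le)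
    rwa [mul_one] at this
  · rw [BoundedContinuousFunction.tendsto_iff_tendstoUniformly] at hlim
    intro V hV
    filter_upwards [hlim V hV] with n hn t ht
    rw [IccExtend_of_mem _ _ ht]
    exact hn ⟨t, ht⟩

/-! ### Integrals along admissible pairs -/

variable {f g h : ℝ → ℝ → ℝ} {K : Set ℝ} {T x₀ : ℝ} {u x : ℝ → ℝ}

theorem IsAdmissiblePair.continuousOn (hT : 0 < T) (hp : IsAdmissiblePair f K T x₀ u x) :
    ContinuousOn x (Icc 0 T) := by
  have := hp.state_absolutelyContinuous.continuousOn
  rwa [uIcc_of_le hT.le] at this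

theorem IsAdmissiblePair.intervalIntegrable (hT : 0 < T) (hp : IsAdmissiblePair f K T x₀ u x)
    (hh : Continuous fun p : ℝ × ℝ => h p.1 p.2) {s t : ℝ} (hs : s ∈ Icc 0 T) (ht : t ∈ Icc 0 T) :
    IntervalIntegrable (fun r => h (x r) (u r)) volume s t :=
  (hp.intervalIntegrable_cost hT hh).mono_set (by
    rw [uIcc_of_le hT.le]; exact (ordConnected_Icc).uIcc_subset hs ht)

/-- Pass from `a.e.` statements on `(0, T)` to `a.e.` statements on subintervals. -/
theorem ae_of_ae_restrict_Ioo {P : ℝ → Prop} (hP : ∀ᵐ t ∂(volume.restrict (Ioo 0 T)), P t)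
    {s t : ℝ} (hs : 0 ≤ s) (ht : t ≤ T) : ∀ᵐ r, r ∈ Ioc s t → P r := by
  rw [ae_restrict_iff' measurableSet_Ioo] at hP
  have hne : ∀ᵐ r : ℝ, r ≠ T := by simp [ae_iff]
  filter_upwards [hP, hne] with r hr hrT hrI
  exact hr ⟨hs.trans_lt hrI.1, lt_of_le_of_ne (hrI.2.trans ht) hrT⟩

theorem IsAdmissiblePair.integral_eq_sub (hp : IsAdmissiblePair f K T x₀ u x)
    {s t : ℝ} (hs : 0 ≤ s) (hst : s ≤ t) (ht : t ≤ T) :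
    ∫ r in s..t, f (x r) (u r) = x t - x s := by
  have hac : AbsolutelyContinuousOnInterval x s t := hp.state_absolutelyContinuous.mono (by
    rw [uIcc_of_le hst, uIcc_of_le (hs.trans (hst.trans ht))]; exact Icc_subset_Icc hs ht)
  rw [← hac.integral_deriv_eq_sub]
  refine intervalIntegral.integral_congr_ae ?_
  rw [uIoc_of_le hst]
  filter_upwards [ae_of_ae_restrict_Ioo hp.state_equation hs ht] with r hr hrI
  exact (hr hrI).deriv.symm

theorem IsAdmissiblePair.mul_le_integral (hT : 0 < T) (hp : IsAdmissiblePair f K T x₀ u x)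
    (hh : Continuous fun p : ℝ × ℝ => h p.1 p.2) {s t κ : ℝ} (hs : 0 ≤ s) (hst : s ≤ t)
    (ht : t ≤ T) (hκ : ∀ r ∈ Ioc s t, ∀ v ∈ K, κ ≤ h (x r) v) :
    κ * (t - s) ≤ ∫ r in s..t, h (x r) (u r) := by
  have h1 : ∫ _ in s..t, κ = κ * (t - s) := by simp [mul_comm]
  rw [← h1]
  refine intervalIntegral.integral_mono_ae_restrict hst (by simp)
    (hp.intervalIntegrable hT hh ⟨hs, hst.trans ht⟩ ⟨hs.trans hst, ht⟩) ?_
  rw [Filter.EventuallyLE, ← restrict_Ioc_eq_restrict_Icc, ae_restrict_iff' measurableSet_Ioc]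
  filter_upwards [ae_of_ae_restrict_Ioo hp.control_mem hs ht] with r hr hrI
  exact hκ r hrI _ (hr hrI)

theorem IsAdmissiblePair.abs_integral_le (hp : IsAdmissiblePair f K T x₀ u x)
    {s t M : ℝ} (hs : 0 ≤ s) (hst : s ≤ t)
    (ht : t ≤ T) (hM : ∀ r ∈ Ioc s t, ∀ v ∈ K, |h (x r) v| ≤ M) :
    |∫ r in s..t, h (x r) (u r)| ≤ M * (t - s) := by
  have := intervalIntegral.norm_integral_le_of_norm_le_const_ae (C := M) (a := s) (b := t)
    (f := fun r => h (x r) (u r)) ?_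
  · rwa [Real.norm_eq_abs, abs_of_nonneg (sub_nonneg.2 hst)] at this
  · rw [uIoc_of_le hst]
    filter_upwards [ae_of_ae_restrict_Ioo hp.control_mem hs ht] with r hr hrI
    exact hM r hrI _ (hr hrI)

/-! ### Limit velocities and measurable controls -/

/-- Limits of the increments of a running integral: if the trajectories `xₙ` converge uniformly to
`w` and the integrals `∫ₛᵗ h(xₙ, uₙ)` converge to the increments of `Z`, then `Z'(t) ≥ κ` for every
lower bound `κ` of `h(w(t), ·)` on the control set. -/
theorem le_deriv_of_tendsto_integral (hK : IsCompact K) (hT : 0 < T)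
    (hh : Continuous fun p : ℝ × ℝ => h p.1 p.2) {us xs : ℕ → ℝ → ℝ}
    (hp : ∀ n, IsAdmissiblePair f K T x₀ (us n) (xs n)) {w Z : ℝ → ℝ}
    (hw : TendstoUniformlyOn xs w atTop (Icc 0 T))
    (hZ : ∀ s t, 0 ≤ s → s ≤ t → t ≤ T →
      Tendsto (fun n => ∫ r in s..t, h (xs n r) (us n r)) atTop (𝓝 (Z t - Z s)))
    {t d κ : ℝ} (ht : t ∈ Ioo 0 T) (hwt : ContinuousAt w t) (hd : HasDerivAt Z d t)
    (hκ : ∀ v ∈ K, κ ≤ h (w t) v) : κ ≤ d := by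
  refine le_of_forall_pos_sub_le fun ε hε => ?_
  -- Compactness of the control set makes the neighbourhood of w(t) independent of v.
  have hev : ∀ᶠ y in 𝓝 (w t), ∀ v ∈ K, κ - ε < h y v :=
    hK.eventually_forall_of_forall_eventually fun v hv =>
      (hh.tendsto (w t, v)).eventually_const_lt (by linarith [hκ v hv])
  obtain ⟨δ, hδ, hball⟩ := Metric.eventually_nhds_iff.1 hev
  obtain ⟨η, hη, hcont⟩ := Metric.continuousAt_iff.1 hwt (δ / 2) (half_pos hδ)
  have hright : ∀ᶠ s in 𝓝[>] t, κ - ε ≤ slope Z t s := by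
    have h1 : ∀ᶠ s in 𝓝[>] t, s < min (t + η) T :=
      (eventually_lt_nhds (by simp [hη, ht.2])).filter_mono nhdsWithin_le_nhds
    filter_upwards [h1, self_mem_nhdsWithin] with s hs hts
    have hts' : t < s := hts
    have hsη : s < t + η := hs.trans_le (min_le_left _ _)
    have hsT : s < T := hs.trans_le (min_le_right _ _)
    have h2 : (κ - ε) * (s - t) ≤ Z s - Z t := by
      refine ge_of_tendsto (hZ t s ht.1.le hts'.le hsT.le) ?_
      filter_upwards [Metric.tendstoUniformlyOn_iff.1 hw (δ / 2) (half_pos hδ)] with n hn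
      refine (hp n).mul_le_integral hT hh ht.1.le hts'.le hsT.le fun r hr v hv => ?_
      have h3 : dist (w r) (xs n r) < δ / 2 := hn r ⟨ht.1.le.trans hr.1.le, hr.2.trans hsT.le⟩
      have h4 : dist (w r) (w t) < δ / 2 := hcont (by
        rw [Real.dist_eq, abs_of_pos (sub_pos.2 hr.1)]; linarith [hr.2])
      refine (hball ?_ v hv).le
      have := dist_triangle_left (xs n r) (w t) (w r)
      linarith
    rw [slope_def_field, le_div_iff₀ (sub_pos.2 hts')]
    exact h2
  have hslope : Tendsto (slope Z t) (𝓝[>] t) (𝓝 d) :=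
    (hasDerivAt_iff_tendsto_slope.1 hd).mono_left
      (nhdsWithin_mono _ fun s (hs : t < s) => ne_of_gt hs)
  exact ge_of_tendsto hslope hright

/-- A measurable selection of controls realising a given measurable velocity. -/
theorem exists_measurable_control {a b : ℝ} (hab : a ≤ b)
    (hf : Continuous fun p : ℝ × ℝ => f p.1 p.2) (hmono : ∀ y, StrictMonoOn (f y) (Icc a b))
    {w v : ℝ → ℝ} (hw : Continuous w) (hv : Measurable v) :
    ∃ u : ℝ → ℝ, Measurable u ∧ (∀ t, u t ∈ Icc a b) ∧
      ∀ t, v t ∈ Icc (f (w t) a) (f (w t) b) → f (w t) (u t) = v t := by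
  have hfc : ∀ c, Continuous fun t => f (w t) c := fun c => hf.comp (hw.prodMk continuous_const)
  -- Clamping the velocity into the attainable interval makes the equation for u solvable at every
  -- t, not only where v is attainable.
  let V : ℝ → ℝ := fun t => max (f (w t) a) (min (v t) (f (w t) b))
  have hV : Measurable V := (hfc a).measurable.max (hv.min (hfc b).measurable)
  have hle : ∀ t, f (w t) a ≤ f (w t) b := fun t =>
    (hmono _).monotoneOn (left_mem_Icc.2 hab) (right_mem_Icc.2 hab) hab
  have hex : ∀ t, ∃ c ∈ Icc a b, f (w t) c = V t := fun t =>
    intermediate_value_Icc hab (hf.comp (continuous_const.prodMk continuous_id)).continuousOn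
      ⟨le_max_left _ _, max_le (hle t) (min_le_right _ _)⟩
  choose u hu huV using hex
  refine ⟨u, measurable_of_Iic fun r => ?_, hu, fun t ht => ?_⟩
  · by_cases hr : r ∈ Icc a b
    -- Strict monotonicity turns the sublevel sets of u into comparisons of measurable functions, so
    -- no selection theorem is needed.
    · have : u ⁻¹' Iic r = {t | V t ≤ f (w t) r} := by
        ext t
        rw [mem_preimage, mem_Iic, ← (hmono (w t)).le_iff_le (hu t) hr, huV]
        rfl
      rw [this]
      exact measurableSet_le hV (hfc r).measurable
    · rcases lt_or_ge r a with hra | hra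
      · have : u ⁻¹' Iic r = ∅ := eq_empty_of_forall_notMem fun t ht =>
          (hra.trans_le (hu t).1).not_ge ht
        rw [this]; exact MeasurableSet.empty
      · have : u ⁻¹' Iic r = univ := eq_univ_of_forall fun t =>
          (hu t).2.trans (le_of_not_ge fun h => hr ⟨hra, h⟩)
        rw [this]; exact MeasurableSet.univ
  · rw [huV]
    simp only [V, min_eq_left ht.2, max_eq_right ht.1]

/-! ### Existence of optimal controls -/

/-- **Filippov's existence theorem** for scalar systems with a compact interval of controls: linear
growth, strict monotonicity of `f(x, ·)`, and running costs that are convex functions of the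
velocity. -/
theorem exists_isOptimalControl {a b A B : ℝ} (hab : a ≤ b) (hT : 0 < T) (hB : 0 ≤ B)
    (hf : Continuous fun p : ℝ × ℝ => f p.1 p.2) (hg : Continuous fun p : ℝ × ℝ => g p.1 p.2)
    (hmono : ∀ y, StrictMonoOn (f y) (Icc a b))
    (hgrow : ∀ y, ∀ v ∈ Icc a b, |f y v| ≤ A + B * |y|)
    (hconv : ∀ y, ∀ v₀ ∈ Icc a b, ∃ p : ℝ, ∀ v ∈ Icc a b, p * (f y v - f y v₀) ≤ g y v - g y v₀)
    (hex : ∃ u x, IsAdmissiblePair f (Icc a b) T x₀ u x) :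
    ∃ u, IsOptimalControl f g (Icc a b) T x₀ u := by
  obtain ⟨R, -, hR⟩ := exists_bound_of_linear_growth A x₀ hT hB
  have hbdd : ∀ u x, IsAdmissiblePair f (Icc a b) T x₀ u x → ∀ t ∈ Icc 0 T, |x t| ≤ R := by
    intro u x hp
    refine hR x hp.state_absolutelyContinuous hp.state_initial ?_
    filter_upwards [hp.state_equation, hp.control_mem] with t h1 h2
    rw [h1.deriv]
    exact hgrow _ _ h2
  have hcpt : IsCompact (Icc (-R) R ×ˢ Icc a b) := isCompact_Icc.prod isCompact_Icc
  obtain ⟨M₁, hM₁⟩ := hcpt.exists_bound_of_continuousOn hf.continuousOn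
  obtain ⟨M₂, hM₂⟩ := hcpt.exists_bound_of_continuousOn hg.continuousOn
  set M : ℝ≥0 := ⟨max 0 (max M₁ M₂), le_max_left _ _⟩ with hM
  have hMf : ∀ y, |y| ≤ R → ∀ v ∈ Icc a b, |f y v| ≤ M := fun y hy v hv =>
    (hM₁ (y, v) ⟨abs_le.1 hy, hv⟩).trans ((le_max_left _ _).trans (le_max_right _ _))
  have hMg : ∀ y, |y| ≤ R → ∀ v ∈ Icc a b, |g y v| ≤ M := fun y hy v hv =>
    (hM₂ (y, v) ⟨abs_le.1 hy, hv⟩).trans ((le_max_right _ _).trans (le_max_right _ _))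
  -- a minimizing sequence
  let S : Set ℝ := {r | ∃ u x, IsAdmissiblePair f (Icc a b) T x₀ u x ∧ cost g T u x = r}
  have hSne : S.Nonempty := by
    obtain ⟨u, x, hp⟩ := hex
    exact ⟨_, u, x, hp, rfl⟩
  have hSb : BddBelow S := by
    refine ⟨-(M * (T - 0)), ?_⟩
    rintro r ⟨u, x, hp, rfl⟩
    exact (abs_le.1 (hp.abs_integral_le le_rfl hT.le le_rfl
      fun r hr v hv => hMg _ (hbdd u x hp r (Ioc_subset_Icc_self hr)) v hv)).1
  obtain ⟨cs, -, hcs, hcsS⟩ := exists_seq_tendsto_sInf hSne hSb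
  choose us xs hp hcost using hcsS
  let J : ℕ → ℝ → ℝ := fun n t => ∫ r in (0 : ℝ)..t, g (xs n r) (us n r)
  have hJsub : ∀ n s t, 0 ≤ s → s ≤ t → t ≤ T →
      ∫ r in s..t, g (xs n r) (us n r) = J n t - J n s := fun n s t hs hst ht =>
    (intervalIntegral.integral_interval_sub_left
      ((hp n).intervalIntegrable hT hg ⟨le_rfl, hT.le⟩ ⟨hs.trans hst, ht⟩)
      ((hp n).intervalIntegrable hT hg ⟨le_rfl, hT.le⟩ ⟨hs, hst.trans ht⟩)).symm
  have hlip : ∀ n, LipschitzOnWith M (fun t => (xs n t, J n t)) (Icc 0 T) := by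
    intro n
    have hb := hbdd _ _ (hp n)
    have hsub : ∀ s ∈ Icc 0 T, ∀ t ∈ Icc 0 T, ∀ r ∈ Ioc s t, |xs n r| ≤ R := fun s hs t ht r hr =>
      hb r ⟨hs.1.trans hr.1.le, hr.2.trans ht.2⟩
    refine LipschitzOnWith.of_dist_le_mul fun s hs t ht => ?_
    wlog hst : s ≤ t generalizing s t
    · rw [dist_comm, dist_comm s]
      exact this t ht s hs (le_of_not_ge hst)
    have e1 := (hp n).abs_integral_le (h := f) (M := M) hs.1 hst ht.2
      fun r hr v hv => hMf _ (hsub s hs t ht r hr) v hv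
    have e2 := (hp n).abs_integral_le (h := g) (M := M) hs.1 hst ht.2
      fun r hr v hv => hMg _ (hsub s hs t ht r hr) v hv
    rw [(hp n).integral_eq_sub hs.1 hst ht.2] at e1
    rw [hJsub n s t hs.1 hst ht.2] at e2
    rw [dist_comm, dist_comm s, Prod.dist_eq, Real.dist_eq, Real.dist_eq, Real.dist_eq,
      abs_of_nonneg (sub_nonneg.2 hst)]
    exact max_le e1 e2
  obtain ⟨φ, hφ, z, hz, hlim⟩ := exists_subseq_tendstoUniformlyOn_of_lipschitzOnWith
    (z₀ := (x₀, (0 : ℝ))) hT hlip fun n => by simp [J, (hp n).state_initial]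
  let x : ℝ → ℝ := fun t => (z t).1
  let Z : ℝ → ℝ := fun t => (z t).2
  have hx : LipschitzWith M x := by
    have := LipschitzWith.prod_fst.comp hz
    rwa [one_mul] at this
  have hZ : LipschitzWith M Z := by
    have := LipschitzWith.prod_snd.comp hz
    rwa [one_mul] at this
  have hxlim : TendstoUniformlyOn (fun n => xs (φ n)) x atTop (Icc 0 T) :=
    uniformContinuous_fst.comp_tendstoUniformlyOn hlim
  have hJlim : TendstoUniformlyOn (fun n => J (φ n)) Z atTop (Icc 0 T) :=
    uniformContinuous_snd.comp_tendstoUniformlyOn hlim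
  have h0T : (0 : ℝ) ∈ Icc 0 T := left_mem_Icc.2 hT.le
  have hTT : T ∈ Icc 0 T := right_mem_Icc.2 hT.le
  have hx0 : x 0 = x₀ := by
    refine tendsto_nhds_unique (hxlim.tendsto_at h0T) ?_
    simp only [(hp _).state_initial]
    exact tendsto_const_nhds
  have hZ0 : Z 0 = 0 := by
    refine tendsto_nhds_unique (hJlim.tendsto_at h0T) ?_
    simp only [J, intervalIntegral.integral_same]
    exact tendsto_const_nhds
  have hZT : Z T = sInf S := by
    refine tendsto_nhds_unique (hJlim.tendsto_at hTT) ?_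
    have : (fun n => J (φ n) T) = cs ∘ φ := funext fun n => hcost (φ n)
    rw [this]
    exact hcs.comp hφ.tendsto_atTop
  -- the velocities of the limit lie in the closed convex hull of the velocity set
  have hhull : ∀ α γ κ : ℝ, ∀ t ∈ Ioo 0 T, DifferentiableAt ℝ x t → DifferentiableAt ℝ Z t →
      (∀ v ∈ Icc a b, κ ≤ α * f (x t) v + γ * g (x t) v) →
      κ ≤ α * deriv x t + γ * deriv Z t := by
    intro α γ κ t ht hxd hZd hκ
    refine le_deriv_of_tendsto_integral (h := fun y v => α * f y v + γ * g y v)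
      (Z := fun t => α * x t + γ * Z t) isCompact_Icc hT
      ((continuous_const.mul hf).add (continuous_const.mul hg)) (fun n => hp (φ n)) hxlim
      (fun s t hs hst ht => ?_) ht hx.continuous.continuousAt
      ((hxd.hasDerivAt.const_mul α).add (hZd.hasDerivAt.const_mul γ)) hκ
    have hsI : s ∈ Icc 0 T := ⟨hs, hst.trans ht⟩
    have htI : t ∈ Icc 0 T := ⟨hs.trans hst, ht⟩
    have e : ∀ n, ∫ r in s..t, (α * f (xs (φ n) r) (us (φ n) r) + γ * g (xs (φ n) r) (us (φ n) r))
        = α * (xs (φ n) t - xs (φ n) s) + γ * (J (φ n) t - J (φ n) s) := by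
      intro n
      rw [intervalIntegral.integral_add
        (((hp _).intervalIntegrable hT hf hsI htI).const_mul α)
        (((hp _).intervalIntegrable hT hg hsI htI).const_mul γ),
        intervalIntegral.integral_const_mul, intervalIntegral.integral_const_mul,
        (hp _).integral_eq_sub hs hst ht, hJsub _ s t hs hst ht]
    simp only [e]
    have e2 : α * x t + γ * Z t - (α * x s + γ * Z s) = α * (x t - x s) + γ * (Z t - Z s) := by
      ring
    rw [e2]
    exact (((hxlim.tendsto_at htI).sub (hxlim.tendsto_at hsI)).const_mul α).add
      (((hJlim.tendsto_at htI).sub (hJlim.tendsto_at hsI)).const_mul γ)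
  obtain ⟨u, hum, huK, huf⟩ := exists_measurable_control hab hf hmono hx.continuous
    (measurable_deriv x)
  have hae : ∀ᵐ t ∂(volume.restrict (Ioo 0 T)), HasDerivAt x (f (x t) (u t)) t ∧
      g (x t) (u t) ≤ deriv Z t := by
    rw [ae_restrict_iff' measurableSet_Ioo]
    filter_upwards [hx.ae_differentiableAt_real, hZ.ae_differentiableAt_real] with t hxd hZd ht
    have haK : a ∈ Icc a b := left_mem_Icc.2 hab
    have hbK : b ∈ Icc a b := right_mem_Icc.2 hab
    -- The half-planes with γ = 0 place x' between f(x, a) and f(x, b), so the selected control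
    -- realises x' exactly.
    have hlo := hhull 1 0 (f (x t) a) t ht hxd hZd fun v hv => by
      linarith [(hmono (x t)).monotoneOn haK hv hv.1]
    have hhi := hhull (-1) 0 (-f (x t) b) t ht hxd hZd fun v hv => by
      linarith [(hmono (x t)).monotoneOn hv hbK hv.2]
    have hfu : f (x t) (u t) = deriv x t := huf t ⟨by linarith, by linarith⟩
    obtain ⟨p, hpv⟩ := hconv (x t) (u t) (huK t)
    -- The half-plane above the supporting line of slope p at u; since f(x, u) = x', the terms in p
    -- cancel and g(x, u) ≤ Z' remains.
    have hcv := hhull (-p) 1 (g (x t) (u t) - p * f (x t) (u t)) t ht hxd hZd fun v hv => by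
      linarith [hpv v hv]
    rw [hfu] at hcv ⊢
    exact ⟨hxd.hasDerivAt, by linarith⟩
  have hpair : IsAdmissiblePair f (Icc a b) T x₀ u x :=
    { control_memLp := memLp_top_of_bound hum.aestronglyMeasurable (max |a| |b|)
        (Eventually.of_forall fun t => abs_le_max_abs_abs (huK t).1 (huK t).2)
      control_mem := Eventually.of_forall huK
      state_absolutelyContinuous := (hx.lipschitzOnWith).absolutelyContinuousOnInterval
      state_initial := hx0
      state_equation := hae.mono fun t ht => ht.1 }
  refine ⟨u, x, hpair, fun v y hvy => ?_⟩
  have hZac : AbsolutelyContinuousOnInterval Z 0 T :=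
    hZ.lipschitzOnWith.absolutelyContinuousOnInterval
  calc cost g T u x ≤ ∫ t in (0 : ℝ)..T, deriv Z t := by
        refine intervalIntegral.integral_mono_ae_restrict hT.le
          (hpair.intervalIntegrable_cost hT hg) hZac.intervalIntegrable_deriv ?_
        rw [← restrict_Ioo_eq_restrict_Icc]
        exact hae.mono fun t ht => ht.2
    _ = sInf S := by rw [hZac.integral_deriv_eq_sub, hZ0, hZT, sub_zero]
    _ ≤ cost g T v y := csInf_le hSb ⟨v, y, hvy, rfl⟩

/-! ### Existence of an admissible pair -/

/-- Existence of a state for a constant control, for Lipschitz fields of (at most) linear growth. -/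
theorem exists_isAdmissiblePair_const {c : ℝ} (hT : 0 < T) (hc : c ∈ K) {L : ℝ≥0}
    (hL : LipschitzWith L fun y => f y c) :
    ∃ u x, IsAdmissiblePair f K T x₀ u x := by
  set F : ℝ → ℝ := fun y => f y c with hF
  have hgrow : ∀ y, |F y| ≤ |F 0| + L * |y| := by
    intro y
    have h1 := hL.dist_le_mul y 0
    rw [Real.dist_eq, Real.dist_eq, sub_zero] at h1
    have h2 := abs_sub_abs_le_abs_sub (F y) (F 0)
    linarith
  obtain ⟨R, hR0, hR⟩ := exists_bound_of_linear_growth |F 0| x₀ hT L.2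
  have hRR : -R ≤ R := by linarith
  -- the truncated field
  let cl : ℝ → ℝ := fun y => projIcc (-R) R hRR y
  have hcl : LipschitzWith 1 cl := by
    have := LipschitzWith.subtype_val (Icc (-R) R) |>.comp (LipschitzWith.projIcc hRR)
    rwa [one_mul] at this
  have hcl_le : ∀ y, |cl y| ≤ R := fun y => abs_le.2 (projIcc (-R) R hRR y).2
  have hcl_eq : ∀ y, |y| ≤ R → cl y = y := fun y hy => by
    simp only [cl, projIcc_of_mem hRR (abs_le.1 hy)]
  have hcl_abs : ∀ y, |cl y| ≤ |y| := by
    intro y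
    rcases le_total |y| R with h | h
    · rw [hcl_eq y h]
    · exact (hcl_le y).trans h
  have hFcl : LipschitzWith L fun y => F (cl y) := by
    have := hL.comp hcl
    rwa [mul_one] at this
  let M : ℝ≥0 := ⟨|F 0| + L * R, by positivity⟩
  have hM : ∀ y, |F (cl y)| ≤ M := fun y => (hgrow _).trans (by
    have := mul_le_mul_of_nonneg_left (hcl_le y) L.2
    change |F 0| + L * |cl y| ≤ |F 0| + L * R
    exact add_le_add_right this _)
  -- The truncated field is bounded by M on the whole line, so the ball of radius M T serves for all
  -- of [0, T] at once.
  have hpl : IsPicardLindelof (fun (_ : ℝ) y => F (cl y)) (⟨0, left_mem_Icc.2 hT.le⟩ : Icc 0 T) x₀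
      (M * ⟨T, hT.le⟩) 0 M L :=
    { lipschitzOnWith := fun _ _ => hFcl.lipschitzOnWith
      continuousOn := fun _ _ => continuousOn_const
      norm_le := fun _ _ y _ => hM y
      mul_max_le := by simp [hT.le]; rfl }
  obtain ⟨x, hx0, hx⟩ := hpl.exists_eq_forall_mem_Icc_hasDerivWithinAt₀
  have hxd : ∀ t ∈ Ioo 0 T, HasDerivAt x (F (cl (x t))) t := fun t ht =>
    (hx t (Ioo_subset_Icc_self ht)).hasDerivAt (Icc_mem_nhds ht.1 ht.2)
  have hac : AbsolutelyContinuousOnInterval x 0 T := by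
    have : LipschitzOnWith M x (Icc 0 T) :=
      (convex_Icc 0 T).lipschitzOnWith_of_nnnorm_hasDerivWithin_le hx fun t _ => hM (x t)
    rw [← uIcc_of_le hT.le] at this
    exact this.absolutelyContinuousOnInterval
  -- Truncation does not increase |y|, so the truncated solution obeys the same growth bound; it
  -- stays in [-R, R], where the truncation is inactive.
  have hxR := hR x hac hx0 (by
    refine (ae_restrict_iff' measurableSet_Ioo).2 (Eventually.of_forall fun t ht => ?_)
    rw [(hxd t ht).deriv]
    exact (hgrow _).trans (add_le_add_right (mul_le_mul_of_nonneg_left (hcl_abs _) L.2) _))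
  refine ⟨fun _ => c, x, memLp_top_const c, Eventually.of_forall fun _ => hc, hac, hx0, ?_⟩
  refine (ae_restrict_iff' measurableSet_Ioo).2 (Eventually.of_forall fun t ht => ?_)
  have := hxd t ht
  rwa [hcl_eq _ (hxR t (Ioo_subset_Icc_self ht))] at this

end ScalarControl

/-! ### The concrete control problem -/

theorem lemma7p3 (c β : ℝ → ℝ)
    (hc : ∃ C : NNReal, LipschitzWith C c) (hβ : ∃ B : NNReal, LipschitzWith B β)
    (hlt : ∀ x : ℝ, β x < min 0 (c x))
    (T : ℝ) (hT : 0 < T) (x₀ : ℝ) :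
    ∃ u : ℝ → ℝ, ScalarControl.IsOptimalControl
      (fun x u => (c x - β x) * u ^ 2 + u ^ 3)
      (fun x u => c x * u ^ 2 + u ^ 3)
      (Set.Icc 1 2) T x₀ u := by
  obtain ⟨C, hC⟩ := hc
  obtain ⟨B, hB⟩ := hβ
  have hβneg : ∀ y, β y < 0 := fun y => (hlt y).trans_le (min_le_left _ _)
  have hpos : ∀ y, 0 < c y - β y := fun y => sub_pos.2 ((hlt y).trans_le (min_le_right _ _))
  have hdiff : LipschitzWith (C + B) fun y => c y - β y := hC.sub hB
  have hcc := hC.continuous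
  have hβc := hB.continuous
  -- The constants come from u² ≤ 4, u³ ≤ 8 and c - β ≤ (c - β)(0) + (C + B)|y|.
  refine ScalarControl.exists_isOptimalControl (A := 4 * (c 0 - β 0) + 8) (B := 4 * (C + B))
    one_le_two hT (by positivity) (by fun_prop) (by fun_prop) (fun y v hv v' hv' hvv' => ?_)
    (fun y v hv => ?_) (fun y v₀ hv₀ => ?_) ?_
  · have h0 : 0 ≤ v := zero_le_one.trans hv.1
    have h1 : v ^ 2 < v' ^ 2 := pow_lt_pow_left₀ hvv' h0 two_ne_zero
    have h2 : v ^ 3 < v' ^ 3 := pow_lt_pow_left₀ hvv' h0 three_ne_zero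
    have h3 := mul_lt_mul_of_pos_left h1 (hpos y)
    exact add_lt_add h3 h2
  · have h0 : 0 ≤ v := zero_le_one.trans hv.1
    have h1 : v ^ 2 ≤ 4 := by nlinarith [hv.2]
    have h2 : v ^ 3 ≤ 8 := by nlinarith [hv.2]
    have h3 := hdiff.dist_le_mul y 0
    rw [Real.dist_eq, Real.dist_eq, sub_zero, NNReal.coe_add] at h3
    have h4 := (le_abs_self _).trans h3
    have h5 := hpos y
    rw [abs_of_nonneg (by positivity)]
    nlinarith
  · -- `g = f + β u²`, and `u²` is a concave function of the velocity
    have h0 : 0 < v₀ := zero_lt_one.trans_le hv₀.1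
    have h5 := hpos y
    have hden : 0 < (c y - β y) + 3 / 2 * v₀ := by positivity
    -- This slope is the quotient of the u-derivatives of g and f at v₀, after cancelling 2 v₀.
    refine ⟨1 + β y / ((c y - β y) + 3 / 2 * v₀), fun v hv => ?_⟩
    have hv0 : 0 < v := zero_lt_one.trans_le hv.1
    -- Tangent-line inequality for the convex function q ↦ q^(3/2) at q = v₀².
    have hcube : 0 ≤ v ^ 3 - v₀ ^ 3 - 3 / 2 * v₀ * (v ^ 2 - v₀ ^ 2) := by
      have : v ^ 3 - v₀ ^ 3 - 3 / 2 * v₀ * (v ^ 2 - v₀ ^ 2) = (v - v₀) ^ 2 * (v + v₀ / 2) := by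
        ring
      rw [this]; positivity
    have key : β y / ((c y - β y) + 3 / 2 * v₀) *
        ((c y - β y) * v ^ 2 + v ^ 3 - ((c y - β y) * v₀ ^ 2 + v₀ ^ 3)) ≤
        β y * (v ^ 2 - v₀ ^ 2) := by
      rw [div_mul_eq_mul_div, div_le_iff₀ hden]
      nlinarith [mul_nonneg (neg_nonneg.2 (hβneg y).le) hcube]
    linarith
  · refine ScalarControl.exists_isAdmissiblePair_const (c := 1) (L := C + B) hT (by norm_num) ?_
    simpa using hdiff.add (LipschitzWith.const (1 : ℝ))
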